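/- Let $\mathbb S^n$ be the space of real symmetric $n\times n$ matrices, $\mathbb S^n_+$ its cone of positive semidefinite matrices, and $A\bullet B=\sum_{i,j}A_{ij}B_{ij}$. For $t\ge 0$ let $A_0(t),A_1(t),\dots,A_m(t)\in\mathbb S^n$ and $b(t)\in\mathbb R^m$ be continuous at $t=0$ (from the right), write $A_k=A_k(0)$, $b=b(0)$, and consider the semidefinite program $$(D_t)\qquad \inf_X\{A_0(t)\bullet X:\ A_k(t)\bullet X=b_k(t)\ (k=1,\dots,m),\ X\in\mathbb S^n_+\},$$ and set $(D)=(D_0)$. Assume that $(D)$ is feasible, that the problem $$(P)\qquad \sup_{y,Z}\Big\{b^Ty:\ \sum_{k=1}^m y_kA_k+Z=A_0,\ y\in\mathbb R^m,\ Z\in\mathbb S^n_+\Big\}$$ is strictly feasible (it has a feasible point $(y,Z)$ with $Z$ positive definite), and that $A_1,\dots,A_m$ are linearly independent. A face of a convex set $C$ is a convex subset $F\subseteq C$ such that whenever $x_1,x_2\in C$ and the open segment $(x_1,x_2)$ meets $F$, both $x_1$ and $x_2$ lie in $F$. The minimal face of $(D_t)$ is the intersection of all faces of $\mathbb S^n_+$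 that contain the feasible region of $(D_t)$. Let $Q$ be an orthogonal $n\times n$ matrix and $0\le r\le n$ an integer such that the minimal face of $(D)$ is $$\left\{Q\begin{pmatrix}O&O\\O&X\end{pmatrix}Q^T:\ X\in\mathbb S^r_+\right\},$$ and for an $n\times n$ matrix $M$ let $M_3$ denote its right bottom $r\times r$ block. Suppose that there exists $\delta>0$ such that for all $t\in[0,\delta]$, $(D_t)$ is feasible and has the same minimal face as $(D)$, and $$\dim\operatorname{span}\{(Q^TA_1(t)Q)_3,\dots,(Q^TA_m(t)Q)_3\}=\dim\operatorname{span}\{(Q^TA_1Q)_3,\dots,(Q^TA_mQ)_3\}.$$ Then the optimal value of $(D_t)$, as a function of $t\ge 0$ with values in $[-\infty,+\infty]$, is continuous at $t=0$. -/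

import Mathlib

open Set Filter Topology
open scoped Matrix

noncomputable section

namespace SDP

/-- The product `A • B = ∑ i, ∑ j, A i j * B i j` of two square matrices. -/
def frob {n : ℕ} (A B : Matrix (Fin n) (Fin n) ℝ) : ℝ :=
  ∑ i, ∑ j, A i j * B i j

/-- The cone of real positive semidefinite (in particular symmetric) `n × n` matrices. -/
def psdCone (n : ℕ) : Set (Matrix (Fin n) (Fin n) ℝ) :=
  {X | X.PosSemidef}

/-- The primal `sup {bᵀ y : ∑ k, y k • A k + Z = A₀, Z ⪰ 0}` is strictly feasible: it has a
feasible point `(y, Z)` with `Z` positive definite. -/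
def PrimalStrictlyFeasible {n m : ℕ} (A₀ : Matrix (Fin n) (Fin n) ℝ)
    (A : Fin m → Matrix (Fin n) (Fin n) ℝ) : Prop :=
  ∃ (y : Fin m → ℝ) (Z : Matrix (Fin n) (Fin n) ℝ), ∑ k, y k • A k + Z = A₀ ∧ Z.PosDef

/-- The feasible region of the dual `inf {A₀ • X : A k • X = b k for all k, X ⪰ 0}`. -/
def dualFeasible {n m : ℕ} (A : Fin m → Matrix (Fin n) (Fin n) ℝ) (b : Fin m → ℝ) :
    Set (Matrix (Fin n) (Fin n) ℝ) :=
  {X | X ∈ psdCone n ∧ ∀ k, frob (A k) X = b k}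

/-- The optimal value of the dual, as an infimum in the extended reals. -/
def dualValue {n m : ℕ} (A₀ : Matrix (Fin n) (Fin n) ℝ)
    (A : Fin m → Matrix (Fin n) (Fin n) ℝ) (b : Fin m → ℝ) : EReal :=
  ⨅ X ∈ dualFeasible A b, ((frob A₀ X : ℝ) : EReal)

/-- `F` is a face of the convex set `C`: a convex subset of `C` that contains `x₁` and `x₂`
whenever `x₁, x₂ ∈ C` and the open segment between them meets `F`. -/
def IsFace {E : Type*} [AddCommGroup E] [Module ℝ E] (C F : Set E) : Prop :=
  Convex ℝ F ∧ IsExtreme ℝ C F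

/-- The minimal face of `C` containing `S`: the intersection of all faces of `C` containing `S`. -/
def minimalFace {E : Type*} [AddCommGroup E] [Module ℝ E] (C S : Set E) : Set E :=
  ⋂₀ {F | IsFace C F ∧ S ⊆ F}

/-- The minimal face of the dual: the minimal face of the positive semidefinite cone containing
the feasible region. -/
def dualMinimalFace {n m : ℕ} (A : Fin m → Matrix (Fin n) (Fin n) ℝ) (b : Fin m → ℝ) :
    Set (Matrix (Fin n) (Fin n) ℝ) :=
  minimalFace (psdCone n) (dualFeasible A b)

/-- The partition of the `n` indices into the first `n - r` and the last `r` ones. -/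
def splitEquiv {n r : ℕ} (hr : r ≤ n) : Fin (n - r) ⊕ Fin r ≃ Fin n :=
  finSumFinEquiv.trans (finCongr (Nat.sub_add_cancel hr))

/-- The `n × n` matrix with the `r × r` matrix `X` as its right bottom block and zeros elsewhere. -/
def corner {n r : ℕ} (hr : r ≤ n) (X : Matrix (Fin r) (Fin r) ℝ) : Matrix (Fin n) (Fin n) ℝ :=
  Matrix.reindex (splitEquiv hr) (splitEquiv hr) (Matrix.fromBlocks 0 0 0 X)

/-- The right bottom `r × r` block `M₃` of an `n × n` matrix `M`. -/
def block3 {n r : ℕ} (hr : r ≤ n) (M : Matrix (Fin n) (Fin n) ℝ) : Matrix (Fin r) (Fin r) ℝ :=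
  (Matrix.reindex (splitEquiv hr).symm (splitEquiv hr).symm M).toBlocks₂₂

/-- The dimension of the span of the reduced blocks `(Qᵀ * A k * Q)₃`. -/
def reducedRank {n m r : ℕ} (hr : r ≤ n) (Q : Matrix (Fin n) (Fin n) ℝ)
    (A : Fin m → Matrix (Fin n) (Fin n) ℝ) : ℕ :=
  Module.finrank ℝ (Submodule.span ℝ (Set.range fun k => block3 hr (Qᵀ * A k * Q)))

end SDP

end

namespace SDP

/-! ### The trace pairing and the corner block. -/

section Frob

variable {n : ℕ}

/-! Continuity splits into two semicontinuities. Lower (`eventually_lt_dualValue`): positive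
definiteness of the primal slack at `t = 0` survives perturbation with a uniform margin, which
bounds the traces of feasible points with objective below a given level. Were the value to drop in
the limit, compactness would give a feasible point of the limit problem that is too cheap. Upper
(`eventually_dualValue_lt`): a nearly optimal point is pushed into the relative interior of the
minimal face, where its `r × r` block is positive definite. Since the minimal face is constant, the
reduced linear system in the block stays consistent; since its rank is constant, solutions continue
along the perturbation (`exists_tendsto_solution`). Positive definiteness is open, so the continued
block is feasible. -/

lemma frob_eq_trace (A B : Matrix (Fin n) (Fin n) ℝ) : frob A B = (Aᵀ * B).trace := by
  simp only [frob, Matrix.trace, Matrix.diag, Matrix.mul_apply, Matrix.transpose_apply]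
  exact Finset.sum_comm

lemma frob_comm (A B : Matrix (Fin n) (Fin n) ℝ) : frob A B = frob B A := by
  simp only [frob, mul_comm]

lemma frob_add_right (A B C : Matrix (Fin n) (Fin n) ℝ) :
    frob A (B + C) = frob A B + frob A C := by
  simp only [frob_eq_trace, mul_add, Matrix.trace_add]

lemma frob_smul_right (A B : Matrix (Fin n) (Fin n) ℝ) (c : ℝ) :
    frob A (c • B) = c * frob A B := by
  simp [frob_eq_trace]

lemma frob_add_left (A B C : Matrix (Fin n) (Fin n) ℝ) :
    frob (A + B) C = frob A C + frob B C := by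
  rw [frob_comm, frob_add_right, frob_comm C, frob_comm C]

lemma frob_smul_left (A B : Matrix (Fin n) (Fin n) ℝ) (c : ℝ) :
    frob (c • A) B = c * frob A B := by
  rw [frob_comm, frob_smul_right, frob_comm]

/-- `frob` as a bilinear map. -/
def frobBilin (n : ℕ) :
    Matrix (Fin n) (Fin n) ℝ →ₗ[ℝ] Matrix (Fin n) (Fin n) ℝ →ₗ[ℝ] ℝ :=
  LinearMap.mk₂ ℝ frob frob_add_left (fun c A B => frob_smul_left A B c) frob_add_right
    (fun c A B => frob_smul_right A B c)

lemma frobBilin_apply (A B : Matrix (Fin n) (Fin n) ℝ) : frobBilin n A B = frob A B := rfl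

lemma frob_sum_smul_left {ι : Type*} (s : Finset ι) (c : ι → ℝ)
    (A : ι → Matrix (Fin n) (Fin n) ℝ) (B : Matrix (Fin n) (Fin n) ℝ) :
    frob (∑ k ∈ s, c k • A k) B = ∑ k ∈ s, c k * frob (A k) B := by
  simp [← frobBilin_apply, map_sum, LinearMap.sum_apply]

lemma frob_sum_smul_right {ι : Type*} (s : Finset ι) (c : ι → ℝ)
    (A : ι → Matrix (Fin n) (Fin n) ℝ) (B : Matrix (Fin n) (Fin n) ℝ) :
    frob B (∑ k ∈ s, c k • A k) = ∑ k ∈ s, c k * frob B (A k) := by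
  simp [← frobBilin_apply, map_sum]

lemma frob_self_eq_zero {A : Matrix (Fin n) (Fin n) ℝ} (h : frob A A = 0) : A = 0 := by
  ext i j
  have h1 := (Finset.sum_eq_zero_iff_of_nonneg
    (fun i _ => Finset.sum_nonneg fun j _ => mul_self_nonneg (A i j))).1 h i (Finset.mem_univ i)
  have h2 := (Finset.sum_eq_zero_iff_of_nonneg
    (fun j _ => mul_self_nonneg (A i j))).1 h1 j (Finset.mem_univ j)
  simpa using h2

lemma continuous_frob :
    Continuous fun p : Matrix (Fin n) (Fin n) ℝ × Matrix (Fin n) (Fin n) ℝ => frob p.1 p.2 := by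
  unfold frob
  fun_prop

lemma tendsto_frob {α : Type*} {l : Filter α} {F G : α → Matrix (Fin n) (Fin n) ℝ}
    {A B : Matrix (Fin n) (Fin n) ℝ} (hF : Tendsto F l (𝓝 A)) (hG : Tendsto G l (𝓝 B)) :
    Tendsto (fun x => frob (F x) (G x)) l (𝓝 (frob A B)) :=
  Tendsto.comp (g := fun p : Matrix (Fin n) (Fin n) ℝ × Matrix (Fin n) (Fin n) ℝ =>
    frob p.1 p.2) (f := fun x => (F x, G x)) (continuous_frob.tendsto (A, B))
    (hF.prodMk_nhds hG)

/-- Factoring `B` as `Cᴴ * C` turns the pairing into the trace of the congruence `C * Aᵀ * Cᴴ`. -/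
lemma frob_nonneg {A B : Matrix (Fin n) (Fin n) ℝ} (hA : A.PosSemidef) (hB : B.PosSemidef) :
    0 ≤ frob A B := by
  open scoped MatrixOrder in
  obtain ⟨C, rfl⟩ := CStarAlgebra.nonneg_iff_eq_star_mul_self.mp hB.nonneg
  rw [frob_eq_trace, Matrix.star_eq_conjTranspose, ← Matrix.mul_assoc, Matrix.trace_mul_comm,
    ← Matrix.mul_assoc]
  exact (hA.transpose.mul_mul_conjTranspose_same C).trace_nonneg

lemma frob_one (X : Matrix (Fin n) (Fin n) ℝ) : frob 1 X = X.trace := by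
  simp [frob_eq_trace]

lemma frob_conj (A Q C : Matrix (Fin n) (Fin n) ℝ) :
    frob A (Q * C * Qᵀ) = frob (Qᵀ * A * Q) C := by
  simp only [frob_eq_trace, Matrix.transpose_mul, Matrix.transpose_transpose]
  rw [← Matrix.mul_assoc, Matrix.trace_mul_comm]
  simp only [Matrix.mul_assoc]

lemma frob_corner {r : ℕ} (hr : r ≤ n) (N : Matrix (Fin n) (Fin n) ℝ)
    (X : Matrix (Fin r) (Fin r) ℝ) : frob N (corner hr X) = frob (block3 hr N) X := by
  unfold frob
  rw [← (splitEquiv hr).sum_comp]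
  simp_rw [← (splitEquiv hr).sum_comp (fun j => N _ j * _)]
  simp [Fintype.sum_sum_type, corner, block3, Matrix.toBlocks₂₂]

end Frob

/-! ### Positive definiteness, compactness and faces of the semidefinite cone. -/

section PosDef

variable {n : ℕ}

lemma isSymm_of_posSemidef {A : Matrix (Fin n) (Fin n) ℝ} (hA : A.PosSemidef) : A.IsSymm := by
  have := hA.isHermitian
  rwa [Matrix.IsHermitian, Matrix.conjTranspose_eq_transpose_of_trivial] at this

lemma isHermitian_of_isSymm {A : Matrix (Fin n) (Fin n) ℝ} (hA : A.IsSymm) : A.IsHermitian := by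
  rwa [Matrix.IsHermitian, Matrix.conjTranspose_eq_transpose_of_trivial]

/-- A symmetric matrix close to a positive definite one is positive definite. -/
lemma eventually_posDef {α : Type*} {l : Filter α} {M : α → Matrix (Fin n) (Fin n) ℝ}
    {M₀ : Matrix (Fin n) (Fin n) ℝ} (hM : Tendsto M l (𝓝 M₀)) (h₀ : M₀.PosDef)
    (hsymm : ∀ᶠ x in l, (M x).IsSymm) : ∀ᶠ x in l, (M x).PosDef := by
  -- Compactness of the unit sphere makes one neighbourhood of `M₀` serve all directions;
  -- homogeneity then gives all vectors.
  have key : ∀ᶠ N in 𝓝 M₀, ∀ v ∈ Metric.sphere (0 : Fin n → ℝ) 1, 0 < v ⬝ᵥ N *ᵥ v := by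
    refine (isCompact_sphere _ _).eventually_forall_of_forall_eventually fun v hv => ?_
    have hc : Continuous fun p : Matrix (Fin n) (Fin n) ℝ × (Fin n → ℝ) =>
        p.2 ⬝ᵥ p.1 *ᵥ p.2 := by
      simp only [dotProduct, Matrix.mulVec]
      fun_prop
    refine hc.continuousAt.eventually_const_lt ?_
    have hv0 : v ≠ 0 := by
      rintro rfl
      simp at hv
    simpa using h₀.dotProduct_mulVec_pos hv0
  filter_upwards [hM.eventually key, hsymm] with x hx hs
  refine Matrix.PosDef.of_dotProduct_mulVec_pos (isHermitian_of_isSymm hs) fun v hv => ?_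
  have hn : 0 < ‖v‖ := norm_pos_iff.2 hv
  have := hx (‖v‖⁻¹ • v) (by simp [norm_smul, hn.ne'])
  rw [Matrix.mulVec_smul, dotProduct_smul, smul_dotProduct, smul_eq_mul, smul_eq_mul] at this
  have h2 := inv_pos.2 hn
  simpa using pos_of_mul_pos_right (pos_of_mul_pos_right this h2.le) h2.le

lemma exists_posDef_sub_smul_one {Z : Matrix (Fin n) (Fin n) ℝ} (hZ : Z.PosDef) :
    ∃ ε : ℝ, 0 < ε ∧ (Z - ε • 1).PosDef := by
  have hsymm := isSymm_of_posSemidef hZ.posSemidef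
  have ht : Tendsto (fun ε : ℝ => Z - ε • (1 : Matrix (Fin n) (Fin n) ℝ)) (𝓝[>] 0) (𝓝 Z) := by
    have : Continuous fun ε : ℝ => Z - ε • (1 : Matrix (Fin n) (Fin n) ℝ) := by fun_prop
    simpa using (this.tendsto 0).mono_left nhdsWithin_le_nhds
  have := eventually_posDef ht hZ (Eventually.of_forall fun ε =>
    hsymm.sub (Matrix.isSymm_one.smul ε))
  obtain ⟨ε, h1, h2⟩ := (this.and self_mem_nhdsWithin).exists
  exact ⟨ε, h2, h1⟩

lemma isClosed_psdCone (n : ℕ) : IsClosed (psdCone n) := by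
  have : psdCone n = {X | Xᵀ = X} ∩ ⋂ v : Fin n → ℝ, {X | 0 ≤ v ⬝ᵥ X *ᵥ v} := by
    ext X
    simp only [psdCone, mem_ofPred_eq, Matrix.posSemidef_iff_dotProduct_mulVec, mem_inter_iff,
      mem_iInter, Matrix.IsHermitian, Matrix.conjTranspose_eq_transpose_of_trivial, star_trivial]
  rw [this]
  refine (isClosed_eq (by fun_prop) continuous_id).inter (isClosed_iInter fun v => ?_)
  refine isClosed_le continuous_const ?_
  simp only [dotProduct, Matrix.mulVec]
  fun_prop

/-- Testing on `eᵢ ± eⱼ` gives `2|X i j| ≤ X i i + X j j`, and diagonal entries are at most the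
trace. -/
lemma abs_apply_le_trace {X : Matrix (Fin n) (Fin n) ℝ} (hX : X.PosSemidef) (i j : Fin n) :
    |X i j| ≤ X.trace := by
  have hs : X j i = X i j := (isSymm_of_posSemidef hX).apply i j
  have hd : ∀ k, X k k ≤ X.trace := fun k =>
    Finset.single_le_sum (f := fun k => X k k) (fun k _ => hX.diag_nonneg) (Finset.mem_univ k)
  have hp := hX.dotProduct_mulVec_nonneg (Pi.single i 1 + Pi.single j 1)
  have hm := hX.dotProduct_mulVec_nonneg (Pi.single i 1 - Pi.single j 1)
  simp [Matrix.mulVec_add, Matrix.mulVec_sub, add_dotProduct, sub_dotProduct, hs] at hp hm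
  have h1 := hd i
  have h2 := hd j
  rw [abs_le]
  constructor <;> linarith

lemma isCompact_psd_trace_le (n : ℕ) (C : ℝ) : IsCompact {X ∈ psdCone n | X.trace ≤ C} := by
  have hK : IsCompact (Set.pi univ fun _ : Fin n => Set.pi univ fun _ : Fin n => Icc (-C) C) :=
    isCompact_univ_pi fun _ => isCompact_univ_pi fun _ => isCompact_Icc
  refine IsCompact.of_isClosed_subset (t := {X ∈ psdCone n | X.trace ≤ C}) hK ?_ ?_
  · have h : IsClosed {X : Matrix (Fin n) (Fin n) ℝ | X.trace ≤ C} :=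
      isClosed_le continuous_id.matrix_trace continuous_const
    exact (isClosed_psdCone n).inter h
  · rintro X ⟨hX, hC⟩ i - j -
    exact abs_le.1 ((abs_apply_le_trace hX i j).trans hC)

lemma convex_psdCone (n : ℕ) : Convex ℝ (psdCone n) := fun _ hX _ hY _ _ ha hb _ =>
  (Matrix.PosSemidef.smul hX ha).add (Matrix.PosSemidef.smul hY hb)

/-- The quadratic form at `v` is a sum of two nonnegative terms, so both vanish, and a semidefinite
matrix kills its isotropic vectors. -/
lemma mulVec_eq_zero_of_add {X Y : Matrix (Fin n) (Fin n) ℝ} (hX : X.PosSemidef)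
    (hY : Y.PosSemidef) {a b : ℝ} (ha : 0 < a) (hb : 0 < b) {v : Fin n → ℝ}
    (h : (a • X + b • Y) *ᵥ v = 0) : X *ᵥ v = 0 ∧ Y *ᵥ v = 0 := by
  have hx := hX.dotProduct_mulVec_nonneg v
  have hy := hY.dotProduct_mulVec_nonneg v
  have h0 : a * (star v ⬝ᵥ X *ᵥ v) + b * (star v ⬝ᵥ Y *ᵥ v) = 0 := by
    have := congrArg (star v ⬝ᵥ ·) h
    simpa [Matrix.add_mulVec, Matrix.smul_mulVec] using this
  rw [← hX.dotProduct_mulVec_zero_iff, ← hY.dotProduct_mulVec_zero_iff]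
  constructor <;> nlinarith [mul_nonneg ha.le hx, mul_nonneg hb.le hy]

/-- The positive semidefinite matrices whose kernel contains that of `X` form a face. -/
lemma isFace_ker (X : Matrix (Fin n) (Fin n) ℝ) :
    IsFace (psdCone n) {Y ∈ psdCone n | ∀ v, X *ᵥ v = 0 → Y *ᵥ v = 0} := by
  refine ⟨?_, ?_⟩
  · rintro Y ⟨hY, hY'⟩ Z ⟨hZ, hZ'⟩ a b ha hb hab
    refine ⟨convex_psdCone n hY hZ ha hb hab, fun v hv => ?_⟩
    simp [Matrix.add_mulVec, Matrix.smul_mulVec, hY' v hv, hZ' v hv]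
  · refine ⟨fun Y hY => hY.1, ?_⟩
    rintro Y hY Z hZ W ⟨-, hW⟩ ⟨a, b, ha, hb, -, rfl⟩
    exact ⟨hY, fun v hv => (mulVec_eq_zero_of_add hY hZ ha hb (hW v hv)).1⟩

lemma convex_dualFeasible {m : ℕ} (A : Fin m → Matrix (Fin n) (Fin n) ℝ) (b : Fin m → ℝ) :
    Convex ℝ (dualFeasible A b) := by
  rintro X ⟨hX, hX'⟩ Y ⟨hY, hY'⟩ c d hc hd hcd
  refine ⟨convex_psdCone n hX hY hc hd hcd, fun k => ?_⟩
  rw [frob_add_right, frob_smul_right, frob_smul_right, hX', hY', ← add_mul, hcd, one_mul]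

/-- A convex set of positive semidefinite matrices has a member of smallest kernel, and that
kernel is contained in the kernel of every matrix of the minimal face. -/
lemma exists_forall_minimalFace_ker {S : Set (Matrix (Fin n) (Fin n) ℝ)} (hS : Convex ℝ S)
    (hne : S.Nonempty) (hpsd : S ⊆ psdCone n) :
    ∃ X ∈ S, ∀ Y ∈ minimalFace (psdCone n) S, ∀ v, X *ᵥ v = 0 → Y *ᵥ v = 0 := by
  let d : Matrix (Fin n) (Fin n) ℝ → ℕ := fun X =>
    Module.finrank ℝ (LinearMap.ker X.mulVecLin)
  obtain ⟨X, hX, hmin⟩ : ∃ X ∈ S, ∀ Y ∈ S, d X ≤ d Y := by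
    obtain ⟨X, hX, h⟩ := WellFounded.has_min (measure d).wf S hne
    exact ⟨X, hX, fun Y hY => not_lt.1 (h Y hY)⟩
  refine ⟨X, hX, fun Y hY => ?_⟩
  refine (mem_sInter.1 hY _ ⟨isFace_ker X, fun Z hZ => ⟨hpsd hZ, fun v hv => ?_⟩⟩).2
  have h2 : (0 : ℝ) < 1 / 2 := by norm_num
  -- The midpoint has kernel inside `ker X`; minimality forces equality, whence `ker X ⊆ ker Z`.
  have hW : (1 / 2 : ℝ) • X + (1 / 2 : ℝ) • Z ∈ S := hS hX hZ h2.le h2.le (by norm_num)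
  have hle : LinearMap.ker ((1 / 2 : ℝ) • X + (1 / 2 : ℝ) • Z).mulVecLin ≤
      LinearMap.ker X.mulVecLin := fun w hw =>
    (mulVec_eq_zero_of_add (hpsd hX) (hpsd hZ) h2 h2 hw).1
  have heq := Submodule.eq_of_le_of_finrank_le hle (hmin _ hW)
  have hv' : v ∈ LinearMap.ker X.mulVecLin := hv
  rw [← heq] at hv'
  exact (mulVec_eq_zero_of_add (hpsd hX) (hpsd hZ) h2 h2 hv').2

lemma subset_minimalFace {E : Type*} [AddCommGroup E] [Module ℝ E] (C S : Set E) :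
    S ⊆ minimalFace C S :=
  subset_sInter fun _ hF => hF.2

end PosDef

/-! ### Parametrizing the face by its block. -/

section Corner

variable {n r : ℕ} (hr : r ≤ n)

lemma corner_posSemidef {W : Matrix (Fin r) (Fin r) ℝ} (hW : W.PosSemidef) :
    (corner hr W).PosSemidef := by
  have : (Matrix.fromBlocks (0 : Matrix (Fin (n - r)) (Fin (n - r)) ℝ) 0 0 W).PosSemidef := by
    refine Matrix.PosSemidef.of_dotProduct_mulVec_nonneg ?_ fun v => ?_
    · exact Matrix.IsHermitian.fromBlocks Matrix.isHermitian_zero (by simp) hW.isHermitian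
    · have := hW.dotProduct_mulVec_nonneg (v ∘ Sum.inr)
      simpa [Matrix.fromBlocks_mulVec, dotProduct, Fintype.sum_sum_type] using this
  exact this.submatrix _

lemma continuous_corner : Continuous (corner hr) := by
  unfold corner
  refine continuous_matrix fun i j => ?_
  simp only [Matrix.reindex_apply, Matrix.submatrix_apply]
  rcases (splitEquiv hr).symm i with i | i <;> rcases (splitEquiv hr).symm j with j | j <;>
    simp <;> fun_prop

/-- The vector with prescribed last `r` entries and zeros elsewhere. -/
def cornerVec (v : Fin r → ℝ) : Fin n → ℝ := Sum.elim 0 v ∘ (splitEquiv hr).symm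

lemma corner_mulVec (W : Matrix (Fin r) (Fin r) ℝ) (v : Fin r → ℝ) :
    corner hr W *ᵥ cornerVec hr v = cornerVec hr (W *ᵥ v) := by
  rw [corner, Matrix.reindex_apply, Matrix.submatrix_mulVec_equiv]
  simp only [cornerVec, Equiv.symm_symm]
  congr 1
  have : (Sum.elim (0 : Fin (n - r) → ℝ) v ∘ (splitEquiv hr).symm) ∘ (splitEquiv hr) =
      Sum.elim (0 : Fin (n - r) → ℝ) v := by
    ext x
    simp
  rw [this, Matrix.fromBlocks_mulVec]
  ext (x | x) <;> simp

lemma cornerVec_eq_zero {v : Fin r → ℝ} (h : cornerVec hr v = 0) : v = 0 := by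
  ext i
  simpa [cornerVec] using congrFun h (splitEquiv hr (Sum.inr i))

lemma block3_isSymm {M : Matrix (Fin n) (Fin n) ℝ} (hM : M.IsSymm) : (block3 hr M).IsSymm := by
  ext i j
  exact hM.apply _ _

lemma continuous_block3 : Continuous (block3 hr) := by
  unfold block3
  exact continuous_matrix fun i j => continuous_id.matrix_elem _ _

/-- The point of the face `{Q * corner W * Qᵀ}` with block `W`. -/
def facePoint (Q : Matrix (Fin n) (Fin n) ℝ) (W : Matrix (Fin r) (Fin r) ℝ) :
    Matrix (Fin n) (Fin n) ℝ :=
  Q * corner hr W * Qᵀ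

lemma frob_facePoint (A Q : Matrix (Fin n) (Fin n) ℝ) (W : Matrix (Fin r) (Fin r) ℝ) :
    frob A (facePoint hr Q W) = frob (block3 hr (Qᵀ * A * Q)) W := by
  rw [facePoint, frob_conj, frob_corner]

lemma continuous_facePoint (Q : Matrix (Fin n) (Fin n) ℝ) : Continuous (facePoint hr Q) := by
  have := continuous_corner hr
  unfold facePoint
  fun_prop

lemma facePoint_posSemidef (Q : Matrix (Fin n) (Fin n) ℝ) {W : Matrix (Fin r) (Fin r) ℝ}
    (hW : W.PosSemidef) : (facePoint hr Q W).PosSemidef := by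
  simpa [facePoint] using (corner_posSemidef hr hW).mul_mul_conjTranspose_same Q

lemma facePoint_mulVec {Q : Matrix (Fin n) (Fin n) ℝ}
    (hQ : Q ∈ Matrix.orthogonalGroup (Fin n) ℝ) (W : Matrix (Fin r) (Fin r) ℝ)
    (v : Fin r → ℝ) :
    facePoint hr Q W *ᵥ (Q *ᵥ cornerVec hr v) = Q *ᵥ cornerVec hr (W *ᵥ v) := by
  have hQ' : Qᵀ * Q = 1 := by
    simpa [Matrix.star_eq_conjTranspose] using (Matrix.mem_orthogonalGroup_iff' _ _).1 hQ
  rw [facePoint, Matrix.mulVec_mulVec, Matrix.mul_assoc, hQ', Matrix.mul_one,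
    ← Matrix.mulVec_mulVec, corner_mulVec]

lemma eq_zero_of_orthogonal_mulVec {Q : Matrix (Fin n) (Fin n) ℝ}
    (hQ : Q ∈ Matrix.orthogonalGroup (Fin n) ℝ) {v : Fin n → ℝ} (h : Q *ᵥ v = 0) : v = 0 := by
  have hQ' : Qᵀ * Q = 1 := by
    simpa [Matrix.star_eq_conjTranspose] using (Matrix.mem_orthogonalGroup_iff' _ _).1 hQ
  rw [← Matrix.one_mulVec v, ← hQ', ← Matrix.mulVec_mulVec, h, Matrix.mulVec_zero]

/-- A feasible point in the relative interior of the minimal face. -/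
lemma exists_posDef_facePoint {Q : Matrix (Fin n) (Fin n) ℝ}
    (hQ : Q ∈ Matrix.orthogonalGroup (Fin n) ℝ) {S : Set (Matrix (Fin n) (Fin n) ℝ)}
    (hS : Convex ℝ S) (hne : S.Nonempty) (hpsd : S ⊆ psdCone n)
    (hface : minimalFace (psdCone n) S = {Y | ∃ W ∈ psdCone r, Y = facePoint hr Q W}) :
    ∃ W : Matrix (Fin r) (Fin r) ℝ, W.PosDef ∧ facePoint hr Q W ∈ S := by
  obtain ⟨X, hX, hker⟩ := exists_forall_minimalFace_ker hS hne hpsd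
  have hXf := subset_minimalFace (psdCone n) S hX
  rw [hface] at hXf hker
  obtain ⟨W, hW, rfl⟩ := hXf
  refine ⟨W, ?_, hX⟩
  -- The face contains the point with identity block, so a null vector of `W` would also be a null
  -- vector of `1`.
  have h1 := hker (facePoint hr Q 1) ⟨1, Matrix.PosSemidef.one, rfl⟩
  refine Matrix.PosDef.of_dotProduct_mulVec_pos hW.isHermitian fun v hv => ?_
  refine lt_of_le_of_ne (hW.dotProduct_mulVec_nonneg v) fun h0 => hv ?_
  have hWv := (hW.dotProduct_mulVec_zero_iff v).1 h0.symm
  have h2 := h1 (Q *ᵥ cornerVec hr v) (by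
    rw [facePoint_mulVec hr hQ, hWv]
    have : cornerVec hr (0 : Fin r → ℝ) = 0 := by
      ext i
      simp only [cornerVec, Function.comp_apply]
      rcases (splitEquiv hr).symm i with j | j <;> simp
    rw [this, Matrix.mulVec_zero])
  rw [facePoint_mulVec hr hQ, Matrix.one_mulVec] at h2
  exact cornerVec_eq_zero hr (eq_zero_of_orthogonal_mulVec hQ h2)

end Corner

/-! ### Continuing solutions of a constant-rank linear system. -/

section Perturbation

variable {r : ℕ}

/-- The Gram matrix of linearly independent matrices is invertible. -/
lemma gram_det_ne_zero {κ : Type*} [Fintype κ] [DecidableEq κ]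
    {N : κ → Matrix (Fin r) (Fin r) ℝ} (hN : LinearIndependent ℝ N) :
    (Matrix.of fun k j => frob (N k) (N j)).det ≠ 0 := by
  intro h
  obtain ⟨c, hc, h0⟩ := Matrix.exists_mulVec_eq_zero_iff.2 h
  have hz : ∑ j, c j • N j = 0 := by
    refine frob_self_eq_zero ?_
    rw [frob_sum_smul_left]
    refine Finset.sum_eq_zero fun k _ => ?_
    rw [frob_sum_smul_right]
    have := congrFun h0 k
    simp only [Matrix.mulVec, dotProduct, Matrix.of_apply, Pi.zero_apply] at this
    rw [← this]
    simp only [mul_comm (c _) (frob _ _)]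
    rw [this, mul_zero]
  exact hc (funext (Fintype.linearIndependent_iff.1 hN c hz))

/-- With `D` fixed, this turns independence of a moving `N` into a condition stable under
perturbation. -/
lemma linearIndependent_of_det_frob_ne_zero {κ : Type*} [Fintype κ] [DecidableEq κ]
    {N D : κ → Matrix (Fin r) (Fin r) ℝ}
    (h : (Matrix.of fun k j => frob (N k) (D j)).det ≠ 0) : LinearIndependent ℝ N := by
  rw [Fintype.linearIndependent_iff]
  intro c hc
  have : c ᵥ* (Matrix.of fun k j => frob (N k) (D j)) = 0 := by
    ext j
    simp only [Matrix.vecMul, dotProduct, Matrix.of_apply, Pi.zero_apply]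
    rw [← frob_sum_smul_left, hc]
    simp [frob]
  exact congrFun (Matrix.eq_zero_of_vecMul_eq_zero h this)

/-- A positive definite solution of a consistent linear system of constant rank can be continued
along a perturbation of the system. -/
lemma exists_tendsto_solution {α : Type*} {l : Filter α} {m : ℕ}
    {M : α → Fin m → Matrix (Fin r) (Fin r) ℝ} {b : α → Fin m → ℝ}
    {M₀ : Fin m → Matrix (Fin r) (Fin r) ℝ} {b₀ : Fin m → ℝ}
    (hM : Tendsto M l (𝓝 M₀)) (hb : Tendsto b l (𝓝 b₀)) (hsymm : ∀ k, (M₀ k).IsSymm)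
    (hcons : ∀ᶠ x in l, ∃ W, ∀ k, frob (M x k) W = b x k)
    (hrank : ∀ᶠ x in l, Module.finrank ℝ (Submodule.span ℝ (range (M x))) =
      Module.finrank ℝ (Submodule.span ℝ (range M₀)))
    {W₀ : Matrix (Fin r) (Fin r) ℝ} (hW₀ : W₀.IsSymm) (hsol : ∀ k, frob (M₀ k) W₀ = b₀ k) :
    ∃ W : α → Matrix (Fin r) (Fin r) ℝ, Tendsto W l (𝓝 W₀) ∧ (∀ x, (W x).IsSymm) ∧
      ∀ᶠ x in l, ∀ k, frob (M x k) (W x) = b x k := by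
  classical
  obtain ⟨κ, a, ha, hspan, hli⟩ := exists_linearIndependent' ℝ M₀
  have : Finite κ := Finite.of_injective a ha
  have : Fintype κ := Fintype.ofFinite κ
  let P : α → Matrix κ κ ℝ := fun x => Matrix.of fun k j => frob (M x (a k)) (M₀ (a j))
  let P₀ : Matrix κ κ ℝ := Matrix.of fun k j => frob (M₀ (a k)) (M₀ (a j))
  have hMk : ∀ k, Tendsto (fun x => M x k) l (𝓝 (M₀ k)) := tendsto_pi_nhds.1 hM
  have hbk : ∀ k, Tendsto (fun x => b x k) l (𝓝 (b₀ k)) := tendsto_pi_nhds.1 hb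
  have hP₀ : P₀.det ≠ 0 := gram_det_ne_zero hli
  have hP : Tendsto P l (𝓝 P₀) :=
    tendsto_pi_nhds.2 fun k => tendsto_pi_nhds.2 fun j =>
      tendsto_frob (hMk (a k)) tendsto_const_nhds
  have hdet : ∀ᶠ x in l, (P x).det ≠ 0 :=
    ((continuous_id.matrix_det.tendsto P₀).comp hP).eventually_ne hP₀
  have hinv : Tendsto (fun x => (P x)⁻¹) l (𝓝 P₀⁻¹) := by
    refine (continuousAt_matrix_inv P₀ ?_).tendsto.comp hP
    simpa using continuousAt_inv₀ hP₀
  -- `ρ` is the residual of `W₀` in the selected equations; a correction in the span of the `M₀ (a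
  -- j)` cancels it, with coefficients tending to `0`.
  let ρ : α → κ → ℝ := fun x k => b x (a k) - frob (M x (a k)) W₀
  have hρ : Tendsto ρ l (𝓝 0) := tendsto_pi_nhds.2 fun k => by
    have := (hbk (a k)).sub (tendsto_frob (hMk (a k)) (tendsto_const_nhds (x := W₀)))
    simpa [hsol] using this
  let c : α → κ → ℝ := fun x => (P x)⁻¹ *ᵥ ρ x
  have hc : Tendsto c l (𝓝 0) := by
    have h : Continuous fun p : Matrix κ κ ℝ × (κ → ℝ) => p.1 *ᵥ p.2 := by fun_prop
    have h2 := (h.tendsto (P₀⁻¹, 0)).comp (hinv.prodMk_nhds hρ)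
    rwa [Matrix.mulVec_zero] at h2
  refine ⟨fun x => W₀ + ∑ j, c x j • M₀ (a j), ?_, fun x => ?_, ?_⟩
  · have : Tendsto (fun x => W₀ + ∑ j, c x j • M₀ (a j)) l
        (𝓝 (W₀ + ∑ j, (0 : ℝ) • M₀ (a j))) :=
      tendsto_const_nhds.add (tendsto_finsetSum _ fun j _ =>
        (tendsto_pi_nhds.1 hc j).smul tendsto_const_nhds)
    simpa using this
  · refine hW₀.add ?_
    rw [Matrix.IsSymm, Matrix.transpose_sum]
    exact Finset.sum_congr rfl fun j _ => (hsymm (a j)).smul _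
  · filter_upwards [hdet, hcons, hrank] with x hx ⟨V, hV⟩ hxr
    have hsel : ∀ k, frob (M x (a k)) (W₀ + ∑ j, c x j • M₀ (a j)) = b x (a k) := fun k => by
      have h1 : P x *ᵥ c x = ρ x := by
        simp only [c, Matrix.mulVec_mulVec]
        rw [Matrix.mul_nonsing_inv _ (isUnit_iff_ne_zero.2 hx), Matrix.one_mulVec]
      have h2 := congrFun h1 k
      simp only [Matrix.mulVec, dotProduct, P, Matrix.of_apply, ρ] at h2
      rw [frob_add_right, frob_sum_smul_right]
      simp only [mul_comm (c x _)]
      rw [h2]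
      ring
    have hlix : LinearIndependent ℝ (M x ∘ a) := linearIndependent_of_det_frob_ne_zero hx
    have hle : Submodule.span ℝ (range (M x ∘ a)) ≤ Submodule.span ℝ (range (M x)) :=
      Submodule.span_mono (range_comp_subset_range a (M x))
    -- Constant rank: the selected matrices still span all constraints.
    have heq := Submodule.eq_of_le_of_finrank_eq hle (by
      rw [hxr, ← hspan, finrank_span_eq_card hlix, finrank_span_eq_card hli])
    -- By consistency `V` solves every equation, so agreeing with `V` on the selected ones suffices.
    let f : Matrix (Fin r) (Fin r) ℝ →ₗ[ℝ] ℝ :=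
      (frobBilin r).flip (W₀ + ∑ j, c x j • M₀ (a j)) - (frobBilin r).flip V
    have hf : Submodule.span ℝ (range (M x)) ≤ LinearMap.ker f := by
      rw [← heq, Submodule.span_le]
      rintro _ ⟨k, rfl⟩
      change frob (M x (a k)) (W₀ + ∑ j, c x j • M₀ (a j)) - frob (M x (a k)) V = 0
      rw [hsel, hV, sub_self]
    intro k
    have h3 := hf (Submodule.subset_span ⟨k, rfl⟩)
    change frob (M x k) (W₀ + ∑ j, c x j • M₀ (a j)) - frob (M x k) V = 0 at h3
    rw [← hV]
    linarith

end Perturbation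

/-! ### Semicontinuity of the optimal value. -/

section Value

variable {n m : ℕ}

lemma dualValue_le {A₀ : Matrix (Fin n) (Fin n) ℝ} {A : Fin m → Matrix (Fin n) (Fin n) ℝ}
    {b : Fin m → ℝ} {X : Matrix (Fin n) (Fin n) ℝ} (hX : X ∈ dualFeasible A b) :
    dualValue A₀ A b ≤ (frob A₀ X : ℝ) :=
  iInf₂_le X hX

/-- Lower semicontinuity of the dual value when the primal is strictly feasible. -/
lemma eventually_lt_dualValue {α : Type*} {l : Filter α} [l.IsCountablyGenerated]
    {A₀ : α → Matrix (Fin n) (Fin n) ℝ} {A : α → Fin m → Matrix (Fin n) (Fin n) ℝ}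
    {b : α → Fin m → ℝ} {B₀ : Matrix (Fin n) (Fin n) ℝ} {B : Fin m → Matrix (Fin n) (Fin n) ℝ}
    {β : Fin m → ℝ} (hA₀ : Tendsto A₀ l (𝓝 B₀)) (hA : Tendsto A l (𝓝 B))
    (hb : Tendsto b l (𝓝 β)) (hA₀s : ∀ᶠ x in l, (A₀ x).IsSymm)
    (hAs : ∀ᶠ x in l, ∀ k, (A x k).IsSymm) (hP : PrimalStrictlyFeasible B₀ B)
    {e : EReal} (he : e < dualValue B₀ B β) :
    ∀ᶠ x in l, e < dualValue (A₀ x) (A x) (b x) := by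
  obtain ⟨c, hec, hcv⟩ := EReal.lt_iff_exists_real_btwn.1 he
  suffices h : ∀ᶠ x in l, ∀ X ∈ dualFeasible (A x) (b x), c ≤ frob (A₀ x) X by
    filter_upwards [h] with x hx
    exact hec.trans_le (le_iInf₂ fun X hX => EReal.coe_le_coe_iff.2 (hx X hX))
  obtain ⟨y, Z, hZ, hZpos⟩ := hP
  obtain ⟨ε, hε, hZε⟩ := exists_posDef_sub_smul_one hZpos
  have hAk : ∀ k, Tendsto (fun x => A x k) l (𝓝 (B k)) := tendsto_pi_nhds.1 hA
  have hbk : ∀ k, Tendsto (fun x => b x k) l (𝓝 (β k)) := tendsto_pi_nhds.1 hb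
  have hslack : ∀ᶠ x in l, (A₀ x - ∑ k, y k • A x k - ε • 1).PosDef := by
    refine eventually_posDef (M₀ := Z - ε • 1) ?_ hZε ?_
    · have : Z = B₀ - ∑ k, y k • B k := by rw [← hZ]; abel
      rw [this]
      exact (hA₀.sub (tendsto_finsetSum _ fun k _ => (hAk k).const_smul (y k))).sub
        tendsto_const_nhds
    · filter_upwards [hA₀s, hAs] with x h1 h2
      refine (h1.sub ?_).sub (Matrix.isSymm_one.smul ε)
      rw [Matrix.IsSymm, Matrix.transpose_sum]
      exact Finset.sum_congr rfl fun j _ => (h2 j).smul _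
  have hbd : ∀ᶠ x in l, ∑ k, y k * β k - 1 < ∑ k, y k * b x k :=
    (tendsto_finsetSum _ fun k _ => (hbk k).const_mul (y k)).eventually_const_lt (by simp)
  by_contra hcon
  rw [not_eventually] at hcon
  obtain ⟨s, hs, hs'⟩ := exists_seq_forall_of_frequently (hcon.and_eventually (hslack.and hbd))
  have hX : ∀ i, ∃ X ∈ dualFeasible (A (s i)) (b (s i)), frob (A₀ (s i)) X < c := fun i => by
    simpa using (hs' i).1
  choose X hXf hXc using hX
  -- Pairing the slack with `X i` gives `ε tr X ≤ A₀ • X - yᵀb`; the `- 1` absorbs the variation of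
  -- `b`.
  have hXK : ∀ i, X i ∈ {X ∈ psdCone n | X.trace ≤ (c - (∑ k, y k * β k - 1)) / ε} := fun i => by
    refine ⟨(hXf i).1, ?_⟩
    have h1 := frob_nonneg (hs' i).2.1.posSemidef (hXf i).1
    have h2 : A₀ (s i) = (A₀ (s i) - ∑ k, y k • A (s i) k - ε • 1) +
        ∑ k, y k • A (s i) k + ε • 1 := by abel
    have h3 := congrArg (frob · (X i)) h2
    simp only [frob_add_left _ _ (X i), frob_sum_smul_left, frob_smul_left, frob_one,
      (hXf i).2] at h3
    rw [le_div_iff₀ hε]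
    linarith [hXc i, (hs' i).2.2]
  have : FirstCountableTopology (Matrix (Fin n) (Fin n) ℝ) :=
    inferInstanceAs (FirstCountableTopology (Fin n → Fin n → ℝ))
  obtain ⟨X₀, hX₀, φ, hφ, hlim⟩ := (isCompact_psd_trace_le n _).tendsto_subseq hXK
  have hsφ : Tendsto (fun i => s (φ i)) atTop l := hs.comp hφ.tendsto_atTop
  have hX₀f : X₀ ∈ dualFeasible B β := by
    refine ⟨hX₀.1, fun k => ?_⟩
    refine tendsto_nhds_unique (tendsto_frob ((hAk k).comp hsφ) hlim) ?_
    refine ((hbk k).comp hsφ).congr fun i => ((hXf (φ i)).2 k).symm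
  have hle : frob B₀ X₀ ≤ c :=
    le_of_tendsto (tendsto_frob (hA₀.comp hsφ) hlim)
      (Eventually.of_forall fun i => (hXc (φ i)).le)
  exact absurd ((dualValue_le hX₀f).trans (EReal.coe_le_coe_iff.2 hle)) (not_le.2 hcv)

/-- Upper semicontinuity of the dual value when the feasible regions stay in the face of `Q` and
the rank of the constraints reduced to that face is constant. -/
lemma eventually_dualValue_lt {r : ℕ} (hr : r ≤ n) {α : Type*} {l : Filter α}
    {A₀ : α → Matrix (Fin n) (Fin n) ℝ} {A : α → Fin m → Matrix (Fin n) (Fin n) ℝ}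
    {b : α → Fin m → ℝ} {B₀ : Matrix (Fin n) (Fin n) ℝ} {B : Fin m → Matrix (Fin n) (Fin n) ℝ}
    {β : Fin m → ℝ} (hA₀ : Tendsto A₀ l (𝓝 B₀)) (hA : Tendsto A l (𝓝 B))
    (hb : Tendsto b l (𝓝 β)) (hBs : ∀ k, (B k).IsSymm)
    {Q : Matrix (Fin n) (Fin n) ℝ} (hQ : Q ∈ Matrix.orthogonalGroup (Fin n) ℝ)
    (hface : dualMinimalFace B β = {Y | ∃ W ∈ psdCone r, Y = facePoint hr Q W})
    (hfeas : ∀ᶠ x in l, (dualFeasible (A x) (b x)).Nonempty)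
    (hsame : ∀ᶠ x in l, dualMinimalFace (A x) (b x) = dualMinimalFace B β)
    (hrank : ∀ᶠ x in l, reducedRank hr Q (A x) = reducedRank hr Q B)
    {e : EReal} (he : dualValue B₀ B β < e) :
    ∀ᶠ x in l, dualValue (A₀ x) (A x) (b x) < e := by
  obtain ⟨X, hX, hXe⟩ : ∃ X ∈ dualFeasible B β, ((frob B₀ X : ℝ) : EReal) < e := by
    simpa [dualValue, iInf_lt_iff] using he
  obtain ⟨c, hXc, hce⟩ := EReal.lt_iff_exists_real_btwn.1 hXe
  rw [EReal.coe_lt_coe_iff] at hXc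
  have hconv := convex_dualFeasible B β
  obtain ⟨V, hV, hVf⟩ := exists_posDef_facePoint hr hQ hconv ⟨X, hX⟩ (fun _ h => h.1) hface
  have hXface := subset_minimalFace (psdCone n) _ hX
  change X ∈ dualMinimalFace B β at hXface
  rw [hface] at hXface
  obtain ⟨U, hU, rfl⟩ := hXface
  -- a feasible point with positive definite block and objective value below `c`
  obtain ⟨W₀, hW₀, hW₀f, hW₀c⟩ : ∃ W₀ : Matrix (Fin r) (Fin r) ℝ, W₀.PosDef ∧
      (∀ k, frob (block3 hr (Qᵀ * B k * Q)) W₀ = β k) ∧ frob B₀ (facePoint hr Q W₀) < c := by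
    have hcont : Continuous fun s : ℝ => frob B₀ (facePoint hr Q ((1 - s) • U + s • V)) := by
      have h1 := continuous_facePoint hr Q
      have h2 : Continuous fun Y => frob B₀ Y :=
        continuous_frob.comp (continuous_const.prodMk continuous_id)
      fun_prop
    have hev : ∀ᶠ s in 𝓝[>] (0 : ℝ),
        frob B₀ (facePoint hr Q ((1 - s) • U + s • V)) < c :=
      nhdsWithin_le_nhds (hcont.continuousAt.eventually_lt_const (by simpa using hXc))
    obtain ⟨s, hs, hs0, hs1⟩ := (hev.and (Ioo_mem_nhdsGT (zero_lt_one' ℝ))).exists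
    refine ⟨(1 - s) • U + s • V, ?_, fun k => ?_, hs⟩
    · exact Matrix.PosDef.posSemidef_add (Matrix.PosSemidef.smul hU (by linarith))
        (Matrix.PosDef.smul hV hs0)
    · rw [frob_add_right, frob_smul_right, frob_smul_right, ← frob_facePoint, ← frob_facePoint,
        hX.2, hVf.2]
      ring
  have hred : Continuous fun N : Matrix (Fin n) (Fin n) ℝ => block3 hr (Qᵀ * N * Q) := by
    have := continuous_block3 hr
    fun_prop
  obtain ⟨W, hW, hWs, hWf⟩ := exists_tendsto_solution
    (M := fun x k => block3 hr (Qᵀ * A x k * Q)) (M₀ := fun k => block3 hr (Qᵀ * B k * Q))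
    (tendsto_pi_nhds.2 fun k => (hred.tendsto _).comp (tendsto_pi_nhds.1 hA k)) hb
    (fun k => block3_isSymm hr (by
      rw [Matrix.IsSymm, Matrix.transpose_mul, Matrix.transpose_mul, Matrix.transpose_transpose,
        (hBs k).eq, Matrix.mul_assoc]))
    (by
      -- A feasible point of the perturbed problem lies in the common face, so its block solves the
      -- reduced system.
      filter_upwards [hfeas, hsame] with x ⟨Y, hY⟩ hx
      have hYface := subset_minimalFace (psdCone n) _ hY
      change Y ∈ dualMinimalFace (A x) (b x) at hYface
      rw [hx, hface] at hYface
      obtain ⟨U', -, rfl⟩ := hYface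
      exact ⟨U', fun k => by rw [← frob_facePoint, hY.2]⟩)
    hrank (isSymm_of_posSemidef hW₀.posSemidef) hW₀f
  have hval : ∀ᶠ x in l, frob (A₀ x) (facePoint hr Q (W x)) < c :=
    (tendsto_frob hA₀ (((continuous_facePoint hr Q).tendsto W₀).comp hW)).eventually_lt_const hW₀c
  filter_upwards [hWf, hval, eventually_posDef hW hW₀ (Eventually.of_forall hWs)] with x h1 h2 h3
  have hfx : facePoint hr Q (W x) ∈ dualFeasible (A x) (b x) :=
    ⟨facePoint_posSemidef hr Q h3.posSemidef, fun k => by rw [frob_facePoint, h1]⟩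
  exact (dualValue_le hfx).trans_lt ((EReal.coe_lt_coe_iff.2 h2).trans hce)

end Value

end SDP

theorem corollary3p1 {n m r : ℕ} (hr : r ≤ n)
    (A₀ : ℝ → Matrix (Fin n) (Fin n) ℝ)
    (A : ℝ → Fin m → Matrix (Fin n) (Fin n) ℝ)
    (b : ℝ → Fin m → ℝ)
    -- the data are symmetric for `t ≥ 0` and continuous at `t = 0`
    (hA₀symm : ∀ t, 0 ≤ t → (A₀ t).IsSymm)
    (hAsymm : ∀ t, 0 ≤ t → ∀ k, (A t k).IsSymm)
    (hA₀cont : ContinuousWithinAt A₀ (Ici 0) 0)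
    (hAcont : ContinuousWithinAt A (Ici 0) 0)
    (hbcont : ContinuousWithinAt b (Ici 0) 0)
    -- at `t = 0` the dual is feasible, the primal is strictly feasible and the constraint
    -- matrices are linearly independent
    (hDfeas : (SDP.dualFeasible (A 0) (b 0)).Nonempty)
    (hPstrict : SDP.PrimalStrictlyFeasible (A₀ 0) (A 0))
    (hAindep : LinearIndependent ℝ (A 0))
    -- the minimal face of the dual at `t = 0` is described by the orthogonal matrix `Q`
    (Q : Matrix (Fin n) (Fin n) ℝ) (hQ : Q ∈ Matrix.orthogonalGroup (Fin n) ℝ)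
    (hface : SDP.dualMinimalFace (A 0) (b 0) =
      {Y | ∃ X ∈ SDP.psdCone r, Y = Q * SDP.corner hr X * Qᵀ})
    (δ : ℝ) (hδ : 0 < δ)
    (hfeas : ∀ t ∈ Icc 0 δ, (SDP.dualFeasible (A t) (b t)).Nonempty)
    (hsame : ∀ t ∈ Icc 0 δ, SDP.dualMinimalFace (A t) (b t) = SDP.dualMinimalFace (A 0) (b 0))
    (hrank : ∀ t ∈ Icc 0 δ, SDP.reducedRank hr Q (A t) = SDP.reducedRank hr Q (A 0)) :
    ContinuousWithinAt (fun t => SDP.dualValue (A₀ t) (A t) (b t)) (Ici 0) 0 := by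
  have hpos : ∀ᶠ t in 𝓝[≥] (0 : ℝ), 0 ≤ t := self_mem_nhdsWithin
  have hIcc : ∀ᶠ t in 𝓝[≥] (0 : ℝ), t ∈ Icc 0 δ := Icc_mem_nhdsGE hδ
  refine tendsto_order.2 ⟨fun e he => ?_, fun e he => ?_⟩
  · exact SDP.eventually_lt_dualValue hA₀cont hAcont hbcont (hpos.mono hA₀symm)
      (hpos.mono hAsymm) hPstrict he
  · exact SDP.eventually_dualValue_lt hr hA₀cont hAcont hbcont (hAsymm 0 le_rfl) hQ hface
      (hIcc.mono hfeas) (hIcc.mono hsame) (hIcc.mono hrank) he
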